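/- Let $d\ge 2$ and let $T$ be the (infinite) $d$-regular tree, i.e. a tree all of whose vertices have degree $d$; let $o$ be any vertex of $T$. For $p\in[0,1]$ let $\mathbb P_p$ be the law of Bernoulli bond percolation on $T$ with parameter $p$, i.e. each edge is independently occupied with probability $p$ and vacant with probability $1-p$. Let $C(o)$ be the connected component of $o$ in the subgraph of occupied edges, and let $\theta(p)=\mathbb P_p(|C(o)|=\infty)$ for $p\in[0,1]$. Put $$p_c=\sup\{p\in[0,1] : \theta(p)=0\},\qquad p_{\mathbb C}=\inf\{p\in[0,1] : \theta \text{ is real-analytic on } (p,1]\},$$ where real-analyticity on $(p,1]$ means that every point of $(p,1]$ (including the end-point $1$) has a neighbourhood $U$ such that on $U\cap(p,1]$ the function $\theta$ agrees with a convergent power series centred at that point. Then $$p_{\mathbb C}=p_c=\frac1{d-1}.$$ Moreover, $\theta$ is real-analytic on the whole supercritical interval $(p_c,1]$. -/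

import Mathlib

namespace BondPercolation

/-- Percolation instances on `G`: each edge is occupied (`true`) or vacant (`false`). -/
abbrev Config {V : Type*} (G : SimpleGraph V) : Type _ := G.edgeSet → Bool

/-- The law `P_p` of Bernoulli bond percolation on `G`: the product, over the edges of `G`, of the
Bernoulli measures that give mass `p` to `true` (occupied) and `1 - p` to `false` (vacant). -/
noncomputable def law {V : Type*} (G : SimpleGraph V) (p : unitInterval) :
    MeasureTheory.Measure (Config G) :=
  MeasureTheory.Measure.infinitePi
    (fun _ : G.edgeSet => ProbabilityTheory.bernoulliMeasure true false p)

/-- The spanning subgraph of `G` formed by the occupied edges. -/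
def openSubgraph {V : Type*} (G : SimpleGraph V) (ω : Config G) : SimpleGraph V :=
  SimpleGraph.fromEdgeSet {e | ∃ h : e ∈ G.edgeSet, ω ⟨e, h⟩ = true}

/-- The cluster `C(o)`: all vertices joined to `o` by a path of occupied edges. -/
def cluster {V : Type*} (G : SimpleGraph V) (ω : Config G) (o : V) : Set V :=
  {v | (openSubgraph G ω).Reachable o v}

/-- The percolation density `θ_o(p) = P_p(|C(o)| = ∞)` for `p ∈ [0, 1]`. It is extended by
constants to the rest of the real line; only its values on `[0, 1]` are ever used below. -/
noncomputable def density {V : Type*} (G : SimpleGraph V) (o : V) (p : ℝ) : ℝ :=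
  (law G (Set.projIcc (0 : ℝ) 1 zero_le_one p)).real {ω | (cluster G ω o).Infinite}

/-- The percolation threshold `p_c = sup {p ∈ [0, 1] | P_p(|C(o)| = ∞) = 0}`. -/
noncomputable def criticalThreshold {V : Type*} (G : SimpleGraph V) (o : V) : ℝ :=
  sSup {p : ℝ | p ∈ Set.Icc (0 : ℝ) 1 ∧ density G o p = 0}

/-- The threshold `p_ℂ = inf {p ∈ [0, 1] | θ_o is analytic in (p, 1]}`. Here `AnalyticOn` looks only
at the values on `(p, 1]`: around each of its points, the end-point `1` included, `θ_o` agrees on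
`(p, 1]` with the sum of a convergent real power series. -/
noncomputable def analyticThreshold {V : Type*} (G : SimpleGraph V) (o : V) : ℝ :=
  sInf {p : ℝ | p ∈ Set.Icc (0 : ℝ) 1 ∧ AnalyticOn ℝ (density G o) (Set.Ioc p 1)}

end BondPercolation

/-! ### The tree rooted at `o`: parents, branches and occupied paths. -/

namespace BondPercolation

open SimpleGraph Relation

variable {V : Type*} {T : SimpleGraph V} {o : V}

/-! Exploring the cluster of `o` away from the root is a branching process with `m = d - 1` children
at every vertex but the root. The cluster is infinite iff occupied downward paths of every length
leave `o` (`cluster_infinite_iff`). Distinct branches use disjoint sets of edges, so they are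
independent, and extinction obeys `x ↦ 1 - p + p * x ^ m` (`law_blocked_succ`). In the limit θ(p) =
1 - u^d, with u the least nonnegative fixed point (`exists_density_eq`).

Cancelling the trivial root 1 leaves p·g(u) = 1 with g(x) = 1 + x + ⋯ + x^(m-1), at most m on [0,1]
(`fixedPoint_iff`). Hence u = 1 and θ = 0 for p < 1/m, while u < 1 and θ > 0 for p > 1/m. If m ≥ 2,
then g' ≠ 0 on [0,∞), and the inverse function theorem makes u, hence θ, analytic above 1/m.
Analyticity cannot extend below: θ vanishes to the left of 1/m and not to the right, against
isolation of zeros. If d = 2, the critical point is the end-point 1, where θ jumps from 0 to 1. -/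

/-- `IsChild T o a b`: in the graph `T` rooted at `o`, the vertex `b` is a child of `a`. -/
def IsChild (T : SimpleGraph V) (o a b : V) : Prop :=
  T.Adj a b ∧ T.dist o b = T.dist o a + 1

lemma isChild_or_isChild_of_adj (hT : T.IsTree) {a b : V} (h : T.Adj a b) :
    IsChild T o a b ∨ IsChild T o b a := by
  rcases hT.dist_eq_dist_add_one_of_adj o h with h' | h'
  · exact Or.inr ⟨h.symm, h'⟩
  · exact Or.inl ⟨h, h'⟩

lemma not_isChild_root {a : V} : ¬ IsChild T o a o := by
  rintro ⟨-, h⟩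
  simp at h

/-- Geodesics from `o` to two parents, each extended by `b`, are paths from `o` to `b`; in a tree
they coincide, and so do their penultimate vertices. -/
lemma IsChild.parent_unique (hT : T.IsTree) {a b c : V} (ha : IsChild T o a b)
    (hc : IsChild T o c b) : a = c := by
  obtain ⟨p, hp⟩ := hT.connected.exists_walk_length_eq_dist o a
  obtain ⟨q, hq⟩ := hT.connected.exists_walk_length_eq_dist o c
  have hp' : (p.concat ha.1).IsPath :=
    Walk.isPath_of_length_eq_dist _ (by rw [Walk.length_concat, hp, ha.2])
  have hq' : (q.concat hc.1).IsPath :=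
    Walk.isPath_of_length_eq_dist _ (by rw [Walk.length_concat, hq, hc.2])
  have := (hT.existsUnique_path o b).unique hp' hq'
  simpa using congrArg Walk.penultimate this

lemma exists_isChild (hT : T.IsTree) {b : V} (hb : b ≠ o) : ∃ a, IsChild T o a b := by
  obtain ⟨p, hp⟩ := hT.connected.exists_walk_length_eq_dist o b
  have hnil : ¬ p.Nil := fun h => hb h.eq.symm
  have hadj : T.Adj p.penultimate b := p.adj_penultimate hnil
  rcases isChild_or_isChild_of_adj (o := o) hT hadj with h | h
  · exact ⟨_, h⟩
  · have h1 := dist_le p.dropLast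
    have h2 := h.2
    have h3 : p.dropLast.length = p.length - 1 := by simp
    omega

/-- `b` is a descendant of `a`, possibly `a` itself. -/
def IsDesc (T : SimpleGraph V) (o : V) : V → V → Prop :=
  ReflTransGen (IsChild T o)

lemma IsDesc.dist_le {a b : V} (h : IsDesc T o a b) : T.dist o a ≤ T.dist o b := by
  induction h with
  | refl => exact le_rfl
  | tail _ h ih => exact ih.trans (by rw [h.2]; exact Nat.le_succ _)

/-- Parents being unique, the ancestors of `c` form a single chain, with one vertex at each distance
from `o`. -/
lemma IsDesc.eq_of_dist_eq (hT : T.IsTree) {a b c : V} (ha : IsDesc T o a c)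
    (hb : IsDesc T o b c) (h : T.dist o a = T.dist o b) : a = b := by
  induction ha with
  | refl =>
    rcases ReflTransGen.cases_tail hb with h' | ⟨e, he, hea⟩
    · exact h'
    · have := IsDesc.dist_le he
      have := hea.2
      omega
  | tail hac hcd ih =>
    rcases ReflTransGen.cases_tail hb with h' | ⟨e, he, hea⟩
    · subst h'
      have := IsDesc.dist_le hac
      have := hcd.2
      omega
    · obtain rfl := hcd.parent_unique hT hea
      exact ih he

/-- The edges of the branch at `w`: those below `w` and the one that joins `w` to its parent. -/
def branchEdges (T : SimpleGraph V) (o w : V) : Set T.edgeSet :=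
  {e | ∃ a b, IsChild T o a b ∧ (e : Sym2 V) = s(a, b) ∧ IsDesc T o w b}

lemma IsChild.eq_of_edge_eq {a b a' b' : V} (h : IsChild T o a b) (h' : IsChild T o a' b')
    (he : s(a, b) = s(a', b')) : b = b' := by
  rcases Sym2.eq_iff.mp he with ⟨-, h2⟩ | ⟨h1, h2⟩
  · exact h2
  · have := h.2
    have := h'.2
    subst h1 h2
    omega

lemma disjoint_branchEdges (hT : T.IsTree) {w w' : V} (hne : w ≠ w')
    (h : T.dist o w = T.dist o w') : Disjoint (branchEdges T o w) (branchEdges T o w') := by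
  rw [Set.disjoint_left]
  rintro e ⟨a, b, hab, he, hb⟩ ⟨a', b', hab', he', hb'⟩
  obtain rfl := hab.eq_of_edge_eq hab' (he.symm.trans he')
  exact hne (hb.eq_of_dist_eq hT hb' h)

lemma mem_branchEdges_self {a b : V} (h : IsChild T o a b) :
    (⟨s(a, b), h.1⟩ : T.edgeSet) ∈ branchEdges T o b :=
  ⟨a, b, h, rfl, ReflTransGen.refl⟩

lemma branchEdges_subset {a b : V} (h : IsChild T o a b) :
    branchEdges T o b ⊆ branchEdges T o a := by
  rintro e ⟨x, y, hxy, he, hy⟩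
  exact ⟨x, y, hxy, he, ReflTransGen.head h hy⟩

lemma notMem_branchEdges {v w x : V} (h : IsChild T o v w) (h' : IsChild T o w x) :
    (⟨s(v, w), h.1⟩ : T.edgeSet) ∉ branchEdges T o x := by
  rintro ⟨a, b, hab, he, hb⟩
  obtain rfl := h.eq_of_edge_eq hab he
  have := hb.dist_le
  have := h'.2
  omega

/-- The edge from `a` to `b` is occupied. -/
def edgeOpen (T : SimpleGraph V) (a b : V) : Set (Config T) :=
  {ω | ∃ h : T.Adj a b, ω ⟨s(a, b), h⟩ = true}

lemma openSubgraph_adj {ω : Config T} {a b : V} :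
    (openSubgraph T ω).Adj a b ↔ ω ∈ edgeOpen T a b := by
  simp only [openSubgraph, fromEdgeSet_adj, Set.mem_ofPred_eq, edgeOpen]
  constructor
  · rintro ⟨h, -⟩
    exact h
  · rintro ⟨h, h'⟩
    exact ⟨⟨h, h'⟩, h.ne⟩

/-- `b` is a child of `a` joined to it by an occupied edge. -/
def IsOpenChild (T : SimpleGraph V) (o : V) (ω : Config T) (a b : V) : Prop :=
  IsChild T o a b ∧ ω ∈ edgeOpen T a b

/-- An occupied step towards the root ends at the unique parent, which is already the previous
vertex of the downward chain, so the chain just gets shorter. -/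
lemma reflTransGen_of_reachable (hT : T.IsTree) {ω : Config T} {v : V}
    (h : (openSubgraph T ω).Reachable o v) : ReflTransGen (IsOpenChild T o ω) o v := by
  rw [reachable_iff_reflTransGen] at h
  induction h with
  | refl => exact ReflTransGen.refl
  | @tail b c _ hbc ih =>
    have hopen := openSubgraph_adj.mp hbc
    rcases isChild_or_isChild_of_adj (o := o) hT hopen.1 with h | h
    · exact ih.tail ⟨h, hopen⟩
    · rcases ReflTransGen.cases_tail ih with h' | ⟨e, he, hea⟩
      · subst h'
        exact absurd h not_isChild_root
      · rwa [h.parent_unique hT hea.1]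

section Children

variable [T.LocallyFinite]

open Classical in
/-- The children of `v` in the graph `T` rooted at `o`. -/
noncomputable def children (T : SimpleGraph V) [T.LocallyFinite] (o v : V) : Finset V :=
  (T.neighborFinset v).filter fun w => T.dist o w = T.dist o v + 1

lemma mem_children {v w : V} : w ∈ children T o v ↔ IsChild T o v w := by
  simp [children, IsChild]

lemma card_children_root (hT : T.IsTree) {d : ℕ} (hreg : T.IsRegularOfDegree d) :
    (children T o o).card = d := by
  have : children T o o = T.neighborFinset o := by
    ext w
    rw [mem_children, mem_neighborFinset]
    refine ⟨fun h => h.1, fun h => ?_⟩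
    exact (isChild_or_isChild_of_adj hT h).resolve_right not_isChild_root
  rw [this, card_neighborFinset_eq_degree, hreg o]

lemma card_children (hT : T.IsTree) {d : ℕ} (hreg : T.IsRegularOfDegree d) {v : V}
    (hv : v ≠ o) : (children T o v).card = d - 1 := by
  classical
  obtain ⟨a, ha⟩ := exists_isChild hT hv
  have : children T o v = (T.neighborFinset v).erase a := by
    ext w
    rw [mem_children, Finset.mem_erase, mem_neighborFinset]
    constructor
    · rintro ⟨h1, h2⟩
      refine ⟨?_, h1⟩
      rintro rfl
      have := ha.2
      omega
    · rintro ⟨h1, h2⟩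
      exact (isChild_or_isChild_of_adj hT h2).resolve_right
        fun h => h1 (h.parent_unique hT ha)
  rw [this, Finset.card_erase_of_mem (by simpa using ha.1.symm), card_neighborFinset_eq_degree,
    hreg v]

lemma finite_setOf_dist_le (hT : T.IsTree) (o : V) (n : ℕ) : {v | T.dist o v ≤ n}.Finite := by
  induction n with
  | zero =>
    refine (Set.finite_singleton o).subset fun v hv => ?_
    have : T.dist o v = 0 := Nat.le_zero.mp hv
    exact ((hT.connected o v).dist_eq_zero_iff.mp this).symm
  | succ n ih =>
    refine ((Set.finite_singleton o).union
      (ih.biUnion fun v _ => (children T o v).finite_toSet)).subset fun v hv => ?_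
    by_cases hvo : v = o
    · exact Or.inl hvo
    · obtain ⟨a, ha⟩ := exists_isChild hT hvo
      refine Or.inr (Set.mem_biUnion (x := a) ?_ (mem_children.mpr ha))
      have := ha.2
      simp only [Set.mem_ofPred_eq] at hv ⊢
      omega

/-- The event that no occupied path of length `n` leads from `v` away from the root `o`. -/
noncomputable def blocked (T : SimpleGraph V) [T.LocallyFinite] (o : V) :
    ℕ → V → Set (Config T)
  -- The empty path always exists, so nothing is blocked at length 0.
  | 0, _ => ∅
  | n + 1, v => ⋂ w ∈ children T o v, ((edgeOpen T v w)ᶜ ∪ blocked T o n w)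

lemma mem_blocked_succ {n : ℕ} {v : V} {ω : Config T} : ω ∈ blocked T o (n + 1) v ↔
    ∀ w, IsChild T o v w → ω ∈ edgeOpen T v w → ω ∈ blocked T o n w := by
  simp only [blocked, Set.mem_iInter, mem_children, Set.mem_union, Set.mem_compl_iff,
    imp_iff_not_or]

lemma blocked_mono (v : V) : Monotone fun n => blocked T o n v := by
  refine monotone_nat_of_le_succ fun n => ?_
  induction n generalizing v with
  | zero => exact Set.empty_subset _
  | succ n ih =>
    intro ω hω
    rw [mem_blocked_succ] at hω ⊢
    exact fun w hw hw' => ih w (hω w hw hw')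

lemma exists_of_notMem_blocked {n : ℕ} {v : V} {ω : Config T} (h : ω ∉ blocked T o n v) :
    ∃ u, T.dist o u = T.dist o v + n ∧ (openSubgraph T ω).Reachable v u := by
  induction n generalizing v with
  | zero => exact ⟨v, rfl, Reachable.refl v⟩
  | succ n ih =>
    rw [mem_blocked_succ] at h
    push Not at h
    obtain ⟨w, hw, hw', hb⟩ := h
    obtain ⟨u, hu, hr⟩ := ih hb
    refine ⟨u, ?_, (openSubgraph_adj.mpr hw').reachable.trans hr⟩
    have := hw.2
    omega

lemma notMem_blocked_of_reflTransGen {n : ℕ} {v u : V} {ω : Config T}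
    (h : ReflTransGen (IsOpenChild T o ω) v u) (hn : T.dist o v + n ≤ T.dist o u) :
    ω ∉ blocked T o n v := by
  induction h using ReflTransGen.head_induction_on generalizing n with
  | refl =>
    obtain rfl : n = 0 := by omega
    exact Set.notMem_empty _
  | head h _ ih =>
    cases n with
    | zero => exact Set.notMem_empty _
    | succ n =>
      intro hb
      refine ih ?_ (mem_blocked_succ.mp hb _ h.1 h.2)
      have := h.1.2
      omega

lemma cluster_infinite_iff (hT : T.IsTree) {ω : Config T} :
    (cluster T ω o).Infinite ↔ ∀ n, ω ∉ blocked T o n o := by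
  constructor
  · intro h n
    obtain ⟨v, hv, hn⟩ := h.exists_notMem_finite (finite_setOf_dist_le hT o n)
    refine notMem_blocked_of_reflTransGen (reflTransGen_of_reachable hT hv) ?_
    simp only [Set.mem_ofPred_eq] at hn
    simp only [SimpleGraph.dist_self]
    omega
  · intro h
    choose u hu hr using fun n => exists_of_notMem_blocked (h n)
    refine Set.infinite_of_injective_forall_mem (f := u) (fun m n hmn => ?_) hr
    have h1 := hu m
    have h2 := hu n
    rw [hmn] at h1
    omega

end Children

end BondPercolation

/-! ### Independence of branches and the extinction recursion. -/

namespace BondPercolation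

open SimpleGraph MeasureTheory ProbabilityTheory Filter Topology

variable {V : Type*} {T : SimpleGraph V} {o : V}

instance (G : SimpleGraph V) (p : unitInterval) : IsProbabilityMeasure (law G p) := by
  unfold law
  infer_instance

/-- The σ-algebra generated by the states of the edges in `S`. -/
abbrev edgeSigma (G : SimpleGraph V) (S : Set G.edgeSet) : MeasurableSpace (Config G) :=
  ⨆ e ∈ S, MeasurableSpace.comap (fun ω : Config G => ω e) inferInstance

lemma edgeSigma_mono {S S' : Set T.edgeSet} (h : S ⊆ S') : edgeSigma T S ≤ edgeSigma T S' :=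
  biSup_mono h

lemma edgeSigma_le (S : Set T.edgeSet) : edgeSigma T S ≤ MeasurableSpace.pi :=
  iSup₂_le fun e _ => (measurable_pi_apply e).comap_le

lemma indep_edgeSigma (p : unitInterval) {S S' : Set T.edgeSet} (h : Disjoint S S') :
    Indep (edgeSigma T S) (edgeSigma T S') (law T p) :=
  indep_iSup_of_disjoint (fun e => (measurable_pi_apply e).comap_le)
    (iIndepFun_infinitePi (X := fun _ b => b) fun _ => measurable_id) h

lemma measurableSet_edgeOpen {a b : V} (h : T.Adj a b) {S : Set T.edgeSet}
    (hS : (⟨s(a, b), h⟩ : T.edgeSet) ∈ S) : MeasurableSet[edgeSigma T S] (edgeOpen T a b) := by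
  refine le_biSup (fun e : T.edgeSet =>
    MeasurableSpace.comap (fun ω : Config T => ω e) inferInstance) hS _ ⟨{true}, trivial, ?_⟩
  ext ω
  simp [edgeOpen, h]

lemma law_edgeOpen (p : unitInterval) {a b : V} (h : T.Adj a b) :
    (law T p).real (edgeOpen T a b) = p := by
  have hpre : edgeOpen T a b = (fun ω : Config T => ω ⟨s(a, b), h⟩) ⁻¹' {true} := by
    ext ω
    simp [edgeOpen, h]
  rw [hpre, ← map_measureReal_apply (measurable_pi_apply _) (measurableSet_singleton _), law,
    Measure.infinitePi_map_eval, bernoulliMeasure_real_apply_of_mem_of_notMem _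
      (measurableSet_singleton _) rfl (by simp)]

lemma law_biInter_of_branch (hT : T.IsTree) (p : unitInterval) {v : V} (s : Finset V)
    (hs : ∀ w ∈ s, IsChild T o v w) (A : V → Set (Config T))
    (hA : ∀ w ∈ s, MeasurableSet[edgeSigma T (branchEdges T o w)] (A w)) :
    (law T p).real (⋂ w ∈ s, A w) = ∏ w ∈ s, (law T p).real (A w) := by
  classical
  induction s using Finset.induction_on with
  | empty => simp
  | insert a s ha ih =>
    rw [Finset.set_biInter_insert, Finset.prod_insert ha,
      ← ih (fun w hw => hs w (Finset.mem_insert_of_mem hw))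
        fun w hw => hA w (Finset.mem_insert_of_mem hw)]
    have hdisj : Disjoint (branchEdges T o a) (⋃ w ∈ s, branchEdges T o w) := by
      simp only [Set.disjoint_iUnion_right]
      intro w hw
      refine disjoint_branchEdges hT (fun h => ha (h ▸ hw)) ?_
      rw [(hs a (Finset.mem_insert_self _ _)).2, (hs w (Finset.mem_insert_of_mem hw)).2]
    have hm : MeasurableSet[edgeSigma T (⋃ w ∈ s, branchEdges T o w)] (⋂ w ∈ s, A w) :=
      Finset.measurableSet_biInter _ fun w hw =>
        edgeSigma_mono (Set.subset_biUnion_of_mem (u := branchEdges T o) hw) _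
          (hA w (Finset.mem_insert_of_mem hw))
    rw [measureReal_def, (Indep_iff _ _ _).mp (indep_edgeSigma p hdisj) _ _
      (hA a (Finset.mem_insert_self _ _)) hm, ENNReal.toReal_mul]
    rfl

variable [T.LocallyFinite]

/-- Plain measurability would not suffice: independence needs the event to depend only on edges
strictly below `v`. -/
lemma measurableSet_blocked (n : ℕ) (v : V) :
    MeasurableSet[edgeSigma T (⋃ w ∈ children T o v, branchEdges T o w)] (blocked T o n v) := by
  induction n generalizing v with
  | zero => exact MeasurableSpace.measurableSet_empty _
  | succ n ih =>
    refine Finset.measurableSet_biInter _ fun w hw => ?_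
    have hc := mem_children.mp hw
    have hsub : branchEdges T o w ⊆ ⋃ w ∈ children T o v, branchEdges T o w :=
      Set.subset_biUnion_of_mem (u := branchEdges T o) hw
    refine MeasurableSet.union (MeasurableSet.compl ?_) ?_
    · exact measurableSet_edgeOpen hc.1 (hsub (mem_branchEdges_self hc))
    · refine edgeSigma_mono (subset_trans (Set.iUnion₂_subset fun x hx => ?_) hsub) _ (ih w)
      exact branchEdges_subset (mem_children.mp hx)

lemma measurableSet_gate (n : ℕ) {v w : V} (h : IsChild T o v w) :
    MeasurableSet[edgeSigma T (branchEdges T o w)] ((edgeOpen T v w)ᶜ ∪ blocked T o n w) := by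
  refine MeasurableSet.union (MeasurableSet.compl ?_) ?_
  · exact measurableSet_edgeOpen h.1 (mem_branchEdges_self h)
  · refine edgeSigma_mono (Set.iUnion₂_subset fun x hx => ?_) _ (measurableSet_blocked n w)
    exact branchEdges_subset (mem_children.mp hx)

lemma law_gate (p : unitInterval) (n : ℕ) {v w : V} (h : IsChild T o v w) :
    (law T p).real ((edgeOpen T v w)ᶜ ∪ blocked T o n w) =
      1 - p + p * (law T p).real (blocked T o n w) := by
  have hdisj : Disjoint {(⟨s(v, w), h.1⟩ : T.edgeSet)}
      (⋃ x ∈ children T o w, branchEdges T o x) := by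
    rw [Set.disjoint_singleton_left]
    simp only [Set.mem_iUnion, not_exists]
    exact fun x hx => notMem_branchEdges h (mem_children.mp hx)
  have ho := measurableSet_edgeOpen h.1 (Set.mem_singleton (⟨s(v, w), h.1⟩ : T.edgeSet))
  have hb := measurableSet_blocked (T := T) (o := o) n w
  have hind := (Indep_iff _ _ _).mp (indep_edgeSigma p hdisj) _ _ ho hb.compl
  have hset : (edgeOpen T v w)ᶜ ∪ blocked T o n w = (edgeOpen T v w ∩ (blocked T o n w)ᶜ)ᶜ := by
    rw [Set.compl_inter, compl_compl]
  have ho' := edgeSigma_le _ _ ho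
  have hb' := edgeSigma_le _ _ hb
  rw [hset, probReal_compl_eq_one_sub (ho'.inter hb'.compl), measureReal_def, hind,
    ENNReal.toReal_mul, ← measureReal_def, ← measureReal_def, law_edgeOpen p h.1,
    probReal_compl_eq_one_sub hb']
  ring

/-- The probability that a given edge does not lead to an occupied path of length `n + 1`
away from the root, in a tree all of whose vertices other than the root have `m` children. -/
def extinctionSeq (m : ℕ) (p : ℝ) : ℕ → ℝ
  | 0 => 1 - p
  | n + 1 => 1 - p + p * extinctionSeq m p n ^ m

/-- The exponent stays a cardinality because the root has `d` children, whereas the induction only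
descends to vertices with `d - 1`. -/
lemma law_blocked_succ (hT : T.IsTree) {d : ℕ} (hreg : T.IsRegularOfDegree d)
    (p : unitInterval) (n : ℕ) (v : V) :
    (law T p).real (blocked T o (n + 1) v) =
      extinctionSeq (d - 1) p n ^ (children T o v).card := by
  induction n generalizing v with
  | zero =>
    rw [blocked, law_biInter_of_branch hT p _ (fun w hw => mem_children.mp hw) _
      fun w hw => measurableSet_gate 0 (mem_children.mp hw),
      Finset.prod_congr rfl fun w hw => law_gate p 0 (mem_children.mp hw)]
    simp [blocked, extinctionSeq]
  | succ n ih =>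
    rw [blocked, law_biInter_of_branch hT p _ (fun w hw => mem_children.mp hw) _
      fun w hw => measurableSet_gate _ (mem_children.mp hw), Finset.prod_congr rfl
      (g := fun _ => extinctionSeq (d - 1) p (n + 1)), Finset.prod_const]
    intro w hw
    have hc := mem_children.mp hw
    have hw : w ≠ o := by
      rintro rfl
      exact not_isChild_root hc
    rw [law_gate p _ hc, ih, card_children hT hreg hw, extinctionSeq]

lemma tendsto_extinctionSeq_pow (hT : T.IsTree) {d : ℕ} (hreg : T.IsRegularOfDegree d)
    (p : unitInterval) :
    Tendsto (fun n => extinctionSeq (d - 1) p n ^ d) atTop (𝓝 (1 - density T o p)) := by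
  have hset : {ω : Config T | (cluster T ω o).Infinite} = (⋃ n, blocked T o n o)ᶜ := by
    ext ω
    simp [cluster_infinite_iff hT]
  have hm : MeasurableSet (⋃ n, blocked T o n o) :=
    MeasurableSet.iUnion fun n => edgeSigma_le _ _ (measurableSet_blocked n o)
  have hd : density T o p = 1 - (law T p).real (⋃ n, blocked T o n o) := by
    rw [density, Set.projIcc_val, hset, probReal_compl_eq_one_sub hm]
  have ht := tendsto_measure_iUnion_atTop (μ := law T p) (blocked_mono (T := T) (o := o) o)
  -- The shift by one skips `blocked T o 0 o`, which the recursion formula does not cover.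
  have ht' := ((ENNReal.tendsto_toReal (measure_ne_top _ _)).comp ht).comp (tendsto_add_atTop_nat 1)
  rw [hd, sub_sub_cancel]
  refine ht'.congr fun n => ?_
  exact (law_blocked_succ hT hreg p n o).trans (by rw [card_children_root hT hreg])

end BondPercolation

/-! ### The fixed-point equation and analyticity of its solution. -/

namespace BondPercolation

open SimpleGraph Filter Topology

/-- The iteration is monotone and starts at `1 - p`, below every nonnegative fixed point, so it
increases to the least one. -/
lemma exists_tendsto_extinctionSeq (m : ℕ) {p : ℝ} (hp : p ∈ Set.Icc (0 : ℝ) 1) :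
    ∃ u ∈ Set.Icc (0 : ℝ) 1, Tendsto (extinctionSeq m p) atTop (𝓝 u) ∧
      u = 1 - p + p * u ^ m ∧ ∀ v, 0 ≤ v → v = 1 - p + p * v ^ m → u ≤ v := by
  obtain ⟨hp0, hp1⟩ := hp
  have h0 : ∀ n, 0 ≤ extinctionSeq m p n := by
    intro n
    induction n with
    | zero => exact sub_nonneg.mpr hp1
    | succ n ih =>
      rw [extinctionSeq]
      have := mul_nonneg hp0 (pow_nonneg ih m)
      linarith
  have hle : ∀ v, 0 ≤ v → v = 1 - p + p * v ^ m → ∀ n, extinctionSeq m p n ≤ v := by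
    intro v hv hfix n
    induction n with
    | zero =>
      rw [extinctionSeq, hfix]
      have := mul_nonneg hp0 (pow_nonneg hv m)
      linarith
    | succ n ih =>
      rw [extinctionSeq, hfix]
      have := mul_le_mul_of_nonneg_left (pow_le_pow_left₀ (h0 n) ih m) hp0
      linarith
  have h1 : ∀ n, extinctionSeq m p n ≤ 1 := hle 1 zero_le_one (by simp)
  have hmono : Monotone (extinctionSeq m p) := by
    refine monotone_nat_of_le_succ fun n => ?_
    induction n with
    | zero =>
      exact le_add_of_nonneg_right (mul_nonneg hp0 (pow_nonneg (h0 0) m))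
    | succ n ih =>
      rw [extinctionSeq, extinctionSeq]
      have := mul_le_mul_of_nonneg_left (pow_le_pow_left₀ (h0 n) ih m) hp0
      linarith
  obtain ⟨u, hu⟩ : ∃ u, Tendsto (extinctionSeq m p) atTop (𝓝 u) :=
    ⟨_, tendsto_atTop_ciSup hmono ⟨1, by rintro _ ⟨n, rfl⟩; exact h1 n⟩⟩
  refine ⟨u, ⟨ge_of_tendsto' hu h0, le_of_tendsto' hu h1⟩, hu, ?_, fun v hv hfix =>
    le_of_tendsto' hu (hle v hv hfix)⟩
  exact tendsto_nhds_unique (hu.comp (tendsto_add_atTop_nat 1))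
    (((hu.pow m).const_mul p).const_add (1 - p))

/-- The geometric sum `1 + x + ⋯ + x ^ (m - 1)`. -/
def geomSum (m : ℕ) (x : ℝ) : ℝ := ∑ i ∈ Finset.range m, x ^ i

lemma geomSum_one (m : ℕ) : geomSum m 1 = m := by simp [geomSum]

lemma geomSum_le {m : ℕ} {x : ℝ} (hx : x ∈ Set.Icc (0 : ℝ) 1) : geomSum m x ≤ m := by
  rw [← geomSum_one]
  exact Finset.sum_le_sum fun i _ => pow_le_pow_left₀ hx.1 hx.2 i

lemma analyticAt_geomSum (m : ℕ) (x : ℝ) : AnalyticAt ℝ (geomSum m) x :=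
  Finset.analyticAt_fun_sum _ fun i _ => analyticAt_id.pow i

lemma fixedPoint_iff {m : ℕ} {p x : ℝ} (hx : x ≠ 1) :
    x = 1 - p + p * x ^ m ↔ p * geomSum m x = 1 := by
  have hg : geomSum m x * (x - 1) = x ^ m - 1 := geom_sum_mul x m
  have hx' : x - 1 ≠ 0 := sub_ne_zero.mpr hx
  constructor
  · intro h
    apply mul_right_cancel₀ hx'
    linear_combination p * hg - h
  · intro h
    linear_combination (x - 1) * (-h) + p * hg

/-- The linear term, present because `2 ≤ m`, already contributes `y - x`; the other terms are
monotone. -/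
lemma sub_le_geomSum_sub {m : ℕ} (hm : 2 ≤ m) {x y : ℝ} (hx : 0 ≤ x) (hxy : x ≤ y) :
    y - x ≤ geomSum m y - geomSum m x := by
  rw [geomSum, geomSum, ← Finset.sum_sub_distrib]
  refine le_trans (by simp) (Finset.single_le_sum (f := fun i => y ^ i - x ^ i) (fun i _ => ?_)
    (Finset.mem_range.mpr hm))
  exact sub_nonneg.mpr (pow_le_pow_left₀ hx hxy i)

lemma abs_sub_le_geomSum_sub {m : ℕ} (hm : 2 ≤ m) {x y : ℝ} (hx : 0 ≤ x) (hy : 0 ≤ y) :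
    |x - y| ≤ |geomSum m x - geomSum m y| := by
  rcases le_total x y with h | h
  · rw [abs_sub_comm, abs_of_nonneg (sub_nonneg.mpr h), abs_sub_comm (geomSum m x)]
    exact (sub_le_geomSum_sub hm hx h).trans (le_abs_self _)
  · rw [abs_of_nonneg (sub_nonneg.mpr h)]
    exact (sub_le_geomSum_sub hm hy h).trans (le_abs_self _)

lemma deriv_geomSum_ne_zero {m : ℕ} (hm : 2 ≤ m) {x : ℝ} (hx : 0 ≤ x) :
    deriv (geomSum m) x ≠ 0 := by
  have hd : HasDerivAt (geomSum m) (∑ i ∈ Finset.range m, (i : ℝ) * x ^ (i - 1)) x :=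
    HasDerivAt.fun_sum fun i _ => hasDerivAt_pow i x
  rw [hd.deriv]
  refine (lt_of_lt_of_le zero_lt_one (le_trans (by simp) (Finset.single_le_sum
    (f := fun i : ℕ => (i : ℝ) * x ^ (i - 1)) (fun i _ => ?_) (Finset.mem_range.mpr hm)))).ne'
  positivity

/-- A nonnegative solution `u` of `p * geomSum m (u p) = 1` depends analytically on `p`. -/
lemma analyticOn_of_mul_geomSum_eq_one {m : ℕ} (hm : 2 ≤ m) {s : Set ℝ} {u : ℝ → ℝ}
    (hs : ∀ p ∈ s, 0 < p) (h0 : ∀ p ∈ s, 0 ≤ u p) (hu : ∀ p ∈ s, p * geomSum m (u p) = 1) :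
    AnalyticOn ℝ u s := by
  intro p hp
  have hinv : ∀ q ∈ s, geomSum m (u q) = q⁻¹ := fun q hq =>
    eq_inv_of_mul_eq_one_right (hu q hq)
  -- Continuity comes first, since the local inverse recovers `u q` only when `u q` is close to `u
  -- p`. It holds because `geomSum` does not contract distances.
  have hcont : Tendsto u (𝓝[s] p) (𝓝 (u p)) := by
    rw [tendsto_iff_dist_tendsto_zero]
    have hi : Tendsto (fun q : ℝ => |q⁻¹ - p⁻¹|) (𝓝[s] p) (𝓝 0) := by
      have : ContinuousAt (fun q : ℝ => |q⁻¹ - p⁻¹|) p :=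
        ((continuousAt_inv₀ (hs p hp).ne').sub continuousAt_const).abs
      simpa [ContinuousAt] using this.tendsto.mono_left nhdsWithin_le_nhds
    refine squeeze_zero' (Eventually.of_forall fun _ => dist_nonneg) ?_ hi
    filter_upwards [self_mem_nhdsWithin] with q hq
    rw [Real.dist_eq, ← hinv q hq, ← hinv p hp]
    exact abs_sub_le_geomSum_sub hm (h0 q hq) (h0 p hp)
  have ha := analyticAt_geomSum m (u p)
  have hd := deriv_geomSum_ne_zero hm (h0 p hp)
  have hloc := ha.analyticAt_localInverse hd
  rw [hinv p hp] at hloc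
  have hcomp := (hloc.comp (f := fun q : ℝ => q⁻¹) (analyticAt_inv (hs p hp).ne')).analyticWithinAt
    (s := s)
  have hev : ∀ᶠ q in 𝓝[s] p,
      u q = (ha.hasStrictDerivAt.localInverse _ _ _ hd ∘ fun q : ℝ => q⁻¹) q := by
    filter_upwards [hcont.eventually (ha.hasStrictDerivAt.eventually_left_inverse hd),
      self_mem_nhdsWithin] with q hq hqs
    rw [Function.comp_apply, ← hinv q hqs, hq]
  exact hcomp.congr_of_eventuallyEq hev (hev.self_of_nhdsWithin hp)

/-! ### The density on both sides of `1 / (d - 1)`, and the two thresholds. -/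

section Tree

variable {V : Type*} {T : SimpleGraph V} [T.LocallyFinite] {d : ℕ}

lemma exists_density_eq (hT : T.IsTree) (hreg : T.IsRegularOfDegree d) (o : V) {p : ℝ}
    (hp : p ∈ Set.Icc (0 : ℝ) 1) :
    ∃ u ∈ Set.Icc (0 : ℝ) 1, density T o p = 1 - u ^ d ∧
      u = 1 - p + p * u ^ (d - 1) ∧ ∀ v, 0 ≤ v → v = 1 - p + p * v ^ (d - 1) → u ≤ v := by
  obtain ⟨u, hu, hlim, hfix, hmin⟩ := exists_tendsto_extinctionSeq (d - 1) hp
  refine ⟨u, hu, ?_, hfix, hmin⟩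
  have := tendsto_nhds_unique (tendsto_extinctionSeq_pow (o := o) hT hreg ⟨p, hp⟩) (hlim.pow d)
  simp only at this
  linarith

lemma density_eq_zero (hT : T.IsTree) (hreg : T.IsRegularOfDegree d) (hd : 2 ≤ d) (o : V)
    {p : ℝ} (hp0 : 0 ≤ p) (hp : p < 1 / ((d - 1 : ℕ) : ℝ)) : density T o p = 0 := by
  have hm : (1 : ℝ) ≤ ((d - 1 : ℕ) : ℝ) := by exact_mod_cast (by omega : 1 ≤ d - 1)
  have hp1 : p ≤ 1 := hp.le.trans (by rw [div_le_one (by linarith)]; exact hm)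
  obtain ⟨u, hu, hdens, hfix, -⟩ := exists_density_eq hT hreg o ⟨hp0, hp1⟩
  have hu1 : u = 1 := by
    by_contra hne
    have h1 := (fixedPoint_iff hne).mp hfix
    have h2 := mul_le_mul_of_nonneg_left (geomSum_le (m := d - 1) hu) hp0
    rw [lt_div_iff₀ (by linarith)] at hp
    linarith
  rw [hdens, hu1]
  simp

lemma density_supercritical (hT : T.IsTree) (hreg : T.IsRegularOfDegree d) (hd : 2 ≤ d)
    (o : V) {p : ℝ} (hp : 1 / ((d - 1 : ℕ) : ℝ) < p) (hp1 : p ≤ 1) :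
    ∃ u, 0 ≤ u ∧ u < 1 ∧ density T o p = 1 - u ^ d ∧ p * geomSum (d - 1) u = 1 := by
  have hm : (1 : ℝ) ≤ ((d - 1 : ℕ) : ℝ) := by exact_mod_cast (by omega : 1 ≤ d - 1)
  have hp0 : 0 < p := lt_trans (by positivity) hp
  obtain ⟨u, hu, hdens, hfix, hmin⟩ := exists_density_eq hT hreg o ⟨hp0.le, hp1⟩
  have hlt : 1 / p < ((d - 1 : ℕ) : ℝ) := by
    rw [div_lt_iff₀ (by linarith)] at hp
    rw [div_lt_iff₀ hp0]
    linarith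
  have hzero : geomSum (d - 1) 0 = 1 := by
    obtain ⟨k, hk⟩ : ∃ k, d - 1 = k + 1 := ⟨d - 2, by omega⟩
    simp [geomSum, hk, Finset.sum_range_succ']
  -- A fixed point `v < 1` exists, so the least one, `u`, is not the trivial root 1.
  obtain ⟨v, hv, hgv⟩ : 1 / p ∈ geomSum (d - 1) '' Set.Icc 0 1 := by
    refine intermediate_value_Icc zero_le_one
      (fun x _ => (analyticAt_geomSum _ x).continuousAt.continuousWithinAt) ⟨?_, ?_⟩
    · rw [hzero, le_div_iff₀ hp0]
      linarith
    · rw [geomSum_one]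
      exact hlt.le
  have hv1 : v ≠ 1 := by
    rintro rfl
    rw [geomSum_one] at hgv
    exact hlt.ne' hgv
  have huv := hmin v hv.1 ((fixedPoint_iff hv1).mpr (by rw [hgv]; field_simp))
  have hu1 : u < 1 := huv.trans_lt (lt_of_le_of_ne hv.2 hv1)
  exact ⟨u, hu.1, hu1, hdens, (fixedPoint_iff hu1.ne).mp hfix⟩

lemma density_pos (hT : T.IsTree) (hreg : T.IsRegularOfDegree d) (hd : 2 ≤ d)
    (o : V) {p : ℝ} (hp : 1 / ((d - 1 : ℕ) : ℝ) < p) (hp1 : p ≤ 1) : 0 < density T o p := by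
  obtain ⟨u, h0, h1, hdens, -⟩ := density_supercritical hT hreg hd o hp hp1
  rw [hdens, sub_pos]
  exact pow_lt_one₀ h0 h1 (by omega)

lemma density_one (hT : T.IsTree) (hreg : T.IsRegularOfDegree d) (hd : 2 ≤ d) (o : V) :
    density T o 1 = 1 := by
  obtain ⟨u, hu, hdens, -, hmin⟩ := exists_density_eq hT hreg o ⟨zero_le_one, le_refl (1 : ℝ)⟩
  have hu0 : u = 0 := le_antisymm
    (hmin 0 le_rfl (by rw [zero_pow (by omega)]; norm_num)) hu.1
  rw [hdens, hu0, zero_pow (by omega), sub_zero]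

lemma analyticOn_density (hT : T.IsTree) (hreg : T.IsRegularOfDegree d) (hd : 2 ≤ d) (o : V) :
    AnalyticOn ℝ (density T o) (Set.Ioc (1 / ((d - 1 : ℕ) : ℝ)) 1) := by
  -- For `d = 2` the interval is empty; otherwise `d - 1 ≥ 2`, as the inverse function argument
  -- requires.
  rcases hd.eq_or_lt with rfl | hd3
  · intro p hp
    have h := hp.1.trans_le hp.2
    norm_num at h
  have hex : ∀ p : ℝ, ∃ u, p ∈ Set.Ioc (1 / ((d - 1 : ℕ) : ℝ)) 1 →
      0 ≤ u ∧ density T o p = 1 - u ^ d ∧ p * geomSum (d - 1) u = 1 := by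
    intro p
    by_cases hp : p ∈ Set.Ioc (1 / ((d - 1 : ℕ) : ℝ)) 1
    · obtain ⟨u, h0, -, h2, h3⟩ := density_supercritical hT hreg hd o hp.1 hp.2
      exact ⟨u, fun _ => ⟨h0, h2, h3⟩⟩
    · exact ⟨0, fun h => absurd h hp⟩
  choose u hu using hex
  have hpos : ∀ p ∈ Set.Ioc (1 / ((d - 1 : ℕ) : ℝ)) 1, 0 < p := fun p hp =>
    lt_of_le_of_lt (by positivity) hp.1
  have ha := analyticOn_of_mul_geomSum_eq_one (m := d - 1) (by omega) hpos
    (fun p hp => (hu p hp).1) fun p hp => (hu p hp).2.2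
  exact ((analyticOn_const (v := (1 : ℝ))).sub (ha.pow d)).congr fun p hp => (hu p hp).2.1

lemma not_analyticOn_density (hT : T.IsTree) (hreg : T.IsRegularOfDegree d) (hd : 2 ≤ d)
    (o : V) {p : ℝ} (hp0 : 0 ≤ p) (hp : p < 1 / ((d - 1 : ℕ) : ℝ)) :
    ¬ AnalyticOn ℝ (density T o) (Set.Ioc p 1) := by
  intro h
  rcases hd.eq_or_lt with rfl | hd3
  -- For `d = 2`, one-sided continuity at the end-point 1 already fails.
  · have hp1 : p < 1 := by simpa using hp
    have hc := (h 1 ⟨hp1, le_rfl⟩).continuousWithinAt.tendsto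
    rw [density_one hT hreg hd] at hc
    have hc' : Tendsto (density T o) (𝓝[<] 1) (𝓝 1) := by
      rw [← nhdsWithin_Ioo_eq_nhdsLT hp1]
      exact hc.mono_left (nhdsWithin_mono _ Set.Ioo_subset_Ioc_self)
    have hz : ∀ᶠ q in 𝓝[<] (1 : ℝ), density T o q = 0 := by
      filter_upwards [Ioo_mem_nhdsLT hp1] with q hq
      exact density_eq_zero hT hreg hd o (hp0.trans hq.1.le) (by simpa using hq.2)
    exact zero_ne_one (tendsto_nhds_unique (tendsto_const_nhds.congr' (hz.mono fun _ h => h.symm))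
      hc')
  -- For `d ≥ 3` the point `c` is interior, so two-sided analyticity there applies: `density` would
  -- vanish identically near `c` or have no other zero nearby.
  · set c : ℝ := 1 / ((d - 1 : ℕ) : ℝ) with hc
    have hc1 : c < 1 := by
      rw [hc, div_lt_one (by exact_mod_cast (by omega : 0 < d - 1))]
      exact_mod_cast (by omega : 1 < d - 1)
    have hat : AnalyticAt ℝ (density T o) c :=
      (isOpen_Ioo.analyticOn_iff_analyticOnNhd.mp (h.mono Set.Ioo_subset_Ioc_self)) c ⟨hp, hc1⟩
    rcases hat.eventually_eq_zero_or_eventually_ne_zero with hz | hz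
    · obtain ⟨q, hq0, hq1⟩ := ((hz.filter_mono nhdsWithin_le_nhds).and
        (Ioo_mem_nhdsGT hc1)).exists
      exact (density_pos hT hreg hd o hq1.1 hq1.2.le).ne' hq0
    · obtain ⟨q, hq0, hq1⟩ := ((hz.filter_mono (nhdsWithin_mono c fun x hx => hx.ne)).and
        (Ioo_mem_nhdsLT hp)).exists
      exact hq0 (density_eq_zero hT hreg hd o (hp0.trans hq1.1.le) hq1.2)

lemma one_div_mem_Icc (hd : 2 ≤ d) : 1 / ((d - 1 : ℕ) : ℝ) ∈ Set.Icc (0 : ℝ) 1 := by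
  have hm : (1 : ℝ) ≤ ((d - 1 : ℕ) : ℝ) := by exact_mod_cast (by omega : 1 ≤ d - 1)
  exact ⟨by positivity, by rw [div_le_one (by linarith)]; exact hm⟩

lemma criticalThreshold_eq (hT : T.IsTree) (hreg : T.IsRegularOfDegree d) (hd : 2 ≤ d)
    (o : V) : criticalThreshold T o = 1 / ((d - 1 : ℕ) : ℝ) := by
  have hc := one_div_mem_Icc hd
  have hpos : 0 < 1 / ((d - 1 : ℕ) : ℝ) := by
    have : 0 < d - 1 := by omega
    positivity
  refine csSup_eq_of_forall_le_of_forall_lt_exists_gt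
    ⟨0, ⟨le_rfl, zero_le_one⟩, density_eq_zero hT hreg hd o le_rfl hpos⟩ ?_ ?_
  · rintro p ⟨hp, hz⟩
    by_contra! hlt
    exact (density_pos hT hreg hd o hlt hp.2).ne' hz
  · intro w hw
    -- The lower bound `w` may be negative; the maximum with 0 keeps `q` in `[0, 1]`.
    obtain ⟨q, hq1, hq2⟩ := exists_between (max_lt hw hpos)
    have hq0 : 0 ≤ q := (le_max_right _ _).trans hq1.le
    exact ⟨q, ⟨⟨hq0, hq2.le.trans hc.2⟩, density_eq_zero hT hreg hd o hq0 hq2⟩,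
      (le_max_left _ _).trans_lt hq1⟩

lemma analyticThreshold_eq (hT : T.IsTree) (hreg : T.IsRegularOfDegree d) (hd : 2 ≤ d)
    (o : V) : analyticThreshold T o = 1 / ((d - 1 : ℕ) : ℝ) := by
  refine IsLeast.csInf_eq ⟨⟨one_div_mem_Icc hd, analyticOn_density hT hreg hd o⟩, ?_⟩
  rintro p ⟨hp, ha⟩
  by_contra! hlt
  exact not_analyticOn_density hT hreg hd o hp.1 hlt ha

end Tree

end BondPercolation

theorem mainTheorem6 {V : Type*} (T : SimpleGraph V) [T.LocallyFinite] (d : ℕ) (hd : 2 ≤ d)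
    (hT : T.IsTree) (hreg : T.IsRegularOfDegree d) (o : V) :
    BondPercolation.analyticThreshold T o = BondPercolation.criticalThreshold T o ∧
      BondPercolation.criticalThreshold T o = 1 / ((d : ℝ) - 1) ∧
      AnalyticOn ℝ (BondPercolation.density T o)
        (Set.Ioc (BondPercolation.criticalThreshold T o) 1) := by
  have hcast : ((d - 1 : ℕ) : ℝ) = (d : ℝ) - 1 := by
    rw [Nat.cast_sub (by omega), Nat.cast_one]
  rw [BondPercolation.analyticThreshold_eq hT hreg hd,
    BondPercolation.criticalThreshold_eq hT hreg hd]
  exact ⟨rfl, by rw [hcast], BondPercolation.analyticOn_density hT hreg hd o⟩
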